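/- Let $k$ be a field of characteristic $0$ and let $X$ be a simplicial complex on a finite vertex set $V$, i.e. a set of non-empty subsets (simplices) of $V$ that contains all singletons and is closed under passing to non-empty subsets. A subcomplex $Y$ of $X$ is a subset of $X$ closed under passing to non-empty subsets (it need not contain all the vertices of $X$, and may be empty). For a finite set $a$ put $A^0(a)=k[t_v\mid v\in a]/(\sum_{v\in a}t_v-1)$, and for $b\subset a$ let $f\mapsto f|_b$ be the algebra map $A^0(a)\to A^0(b)$ with $t_v\mapsto t_v$ for $v\in b$ and $t_v\mapsto 0$ for $v\notin b$. For a subcomplex $Y$ of $X$ let $A^0(Y)$ be the $k$-algebra of families $(f_a)_{a\in Y}$, $f_a\in A^0(a)$, with $f_a|_b=f_b$ for all simplices $b\subset a$ of $Y$, and let $\Omega^q(Y)=\Lambda^q_{A^0(Y)}\,\Omega^1_{A^0(Y)/k}$, $q\ge 0$, be the space of algebraic $q$-forms (the degree $q$ part of the universal commutative dg-algebra on $A^0(Y)$). For $Z\subset Y$ there are restriction maps $\omega\mapsto\omega|_Z$, $\Omega^q(Y)\to\Omega^q(Z)$. For $p\ge -1$ and a sequence $u=(u_0,\dots,u_p)$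 of vertices of $X$ let $\mathrm{St}\,u$ be the smallest subcomplex of $X$ containing all simplices of $X$ that contain $u_0,\dots,u_p$; so $\mathrm{St}\,u=X$ for $p=-1$. Let $\mathcal C^{p,q}$ be the space of families $(\omega_u)_{u\in V^{p+1}}$, $\omega_u\in\Omega^q(\mathrm{St}\,u)$, such that $\omega_{\sigma u}=\mathrm{sgn}(\sigma)\,\omega_u$ for every permutation $\sigma\in\Sigma_{p+1}$; for $p=-1$ this is $\mathcal C^{-1,q}=\Omega^q(X)$. Let $\delta:\mathcal C^{p,q}\to\mathcal C^{p+1,q}$ be given by $$(\delta\omega)_s=\sum_{i=0}^{p+1}(-1)^i\,\omega_{\partial_i s}|_{\mathrm{St}\,s},\qquad \partial_i s=(s_0,\dots,\widehat{s_i},\dots,s_{p+1}).$$ Then for every $q\ge 0$ the sequence $$0\to\Omega^q(X)=\mathcal C^{-1,q}\xrightarrow{\ \delta\ }\mathcal C^{0,q}\xrightarrow{\ \delta\ }\mathcal C^{1,q}\xrightarrow{\ \delta\ }\cdots$$ is an exact complex. -/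

import Mathlib

open scoped KaehlerDifferential

noncomputable section

namespace PolyForms

/-! ## Algebraic forms -/

section AlgebraicForms

variable (k : Type*) [Field k]

/-- `Ω^q_A`, the degree `q` part of the universal commutative dg-algebra on the commutative
`k`-algebra `A`: the `q`-th exterior power over `A` of the Kähler differentials of `A` over `k`. -/
abbrev AlgForms (A : Type*) [CommRing A] [Algebra k A] (q : ℕ) : Type _ := ⋀[A]^q Ω[A⁄k]

variable {k} {A B C : Type*} [CommRing A] [Algebra k A] [CommRing B] [Algebra k B]
  [CommRing C] [Algebra k C]

/-- The map `Ω^q_A → Ω^q_B` induced by a homomorphism of `k`-algebras `φ : A → B`. It is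
characterized by `algFormsMap_smul_D`: it sends `a • (d b₁ ∧ ⋯ ∧ d b_q)` to
`φ a • (d (φ b₁) ∧ ⋯ ∧ d (φ b_q))`. -/
def algFormsMap (φ : A →ₐ[k] B) (q : ℕ) : AlgForms k A q →ₗ[k] AlgForms k B q :=
  letI : Algebra A B := φ.toRingHom.toAlgebra
  haveI : IsScalarTower k A B := IsScalarTower.of_algHom φ
  let f : MultilinearMap A (fun _ : Fin q => Ω[A⁄k]) (AlgForms k B q) :=
    (MultilinearMap.restrictScalars A
      (exteriorPower.ιMulti B q (M := Ω[B⁄k])).toMultilinearMap).compLinearMap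
        fun _ => KaehlerDifferential.map k k A B
  let g : Ω[A⁄k] [⋀^Fin q]→ₗ[A] AlgForms k B q :=
    { f with
      map_eq_zero_of_eq' := fun _ _ _ hv hij =>
        (exteriorPower.ιMulti B q (M := Ω[B⁄k])).map_eq_zero_of_eq _
          (congrArg (KaehlerDifferential.map k k A B) hv) hij }
  (exteriorPower.alternatingMapLinearEquiv g).restrictScalars k

theorem algFormsMap_smul_D (φ : A →ₐ[k] B) (q : ℕ) (a : A) (b : Fin q → A) :
    algFormsMap φ q
        (a • exteriorPower.ιMulti A q fun i => KaehlerDifferential.D k A (b i)) =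
      φ a • exteriorPower.ιMulti B q fun i => KaehlerDifferential.D k B (φ (b i)) := by
  let _ : Algebra A B := φ.toRingHom.toAlgebra
  have _ : IsScalarTower k A B := IsScalarTower.of_algHom φ
  have h : φ a • (exteriorPower.ιMulti B q fun i => KaehlerDifferential.D k B (φ (b i))) =
      a • (exteriorPower.ιMulti B q fun i => KaehlerDifferential.D k B (φ (b i))) :=
    algebraMap_smul B a (exteriorPower.ιMulti B q fun i => KaehlerDifferential.D k B (φ (b i)))
  rw [h]
  simp only [algFormsMap, LinearMap.coe_restrictScalars, map_smul,
    exteriorPower.alternatingMapLinearEquiv_apply_ιMulti]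
  congr 1
  change exteriorPower.ιMulti B q (fun i => KaehlerDifferential.map k k A B _) = _
  simp only [KaehlerDifferential.map_D]
  rfl

/-- The forms `a • (d b₁ ∧ ⋯ ∧ d b_q)` span `Ω^q_A`, so linear maps agreeing on them are equal. -/
theorem algForms_hom_ext {M : Type*} [AddCommGroup M] [Module k M] {q : ℕ}
    {f g : AlgForms k A q →ₗ[k] M}
    (h : ∀ (a : A) (b : Fin q → A),
      f (a • exteriorPower.ιMulti A q fun i => KaehlerDifferential.D k A (b i)) =
        g (a • exteriorPower.ιMulti A q fun i => KaehlerDifferential.D k A (b i))) :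
    f = g := by
  ext1 x
  have hx : x ∈ Submodule.span A (exteriorPower.ιMulti A q ''
      {m | Set.range m ⊆ Set.range (KaehlerDifferential.D k A)}) := by
    rw [exteriorPower.ιMulti_span_of_span A q Ω[A⁄k]
      (KaehlerDifferential.span_range_derivation k A)]
    trivial
  suffices H : ∀ a : A, f (a • x) = g (a • x) by simpa using H 1
  induction hx using Submodule.span_induction with
  | mem x hx =>
    obtain ⟨m, hm, rfl⟩ := hx
    choose b hb using fun i => hm ⟨i, rfl⟩
    obtain rfl : (fun i => KaehlerDifferential.D k A (b i)) = m := funext hb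
    exact fun a => h a b
  | zero => simp
  | add x y _ _ hx hy => intro a; simp only [smul_add, map_add, hx, hy]
  | smul c x _ hx => intro a; simpa only [smul_smul] using hx (a * c)

theorem algFormsMap_id (q : ℕ) : algFormsMap (AlgHom.id k A) q = LinearMap.id :=
  algForms_hom_ext fun a b => by simp [algFormsMap_smul_D]

theorem algFormsMap_comp (ψ : B →ₐ[k] C) (φ : A →ₐ[k] B) (q : ℕ) :
    algFormsMap (ψ.comp φ) q = algFormsMap ψ q ∘ₗ algFormsMap φ q :=
  algForms_hom_ext fun a b => by simp [algFormsMap_smul_D]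

end AlgebraicForms

/-! ## Polynomial functions on simplicial complexes -/

section PolynomialFunctions

variable (k : Type*) [Field k] {E : Type*}

/-- The algebra `A⁰(a) = k[t_v | v ∈ a] / (∑ t_v - 1)` of polynomial functions on a simplex `a`. -/
def SimplexFun (a : Finset E) : Type _ :=
  MvPolynomial {v // v ∈ a} k ⧸
    Ideal.span {∑ v, MvPolynomial.X v - (1 : MvPolynomial {v // v ∈ a} k)}

instance (a : Finset E) : CommRing (SimplexFun k a) :=
  inferInstanceAs (CommRing (MvPolynomial {v // v ∈ a} k ⧸
    Ideal.span {∑ v, MvPolynomial.X v - (1 : MvPolynomial {v // v ∈ a} k)}))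

instance (a : Finset E) : Algebra k (SimplexFun k a) :=
  inferInstanceAs (Algebra k (MvPolynomial {v // v ∈ a} k ⧸
    Ideal.span {∑ v, MvPolynomial.X v - (1 : MvPolynomial {v // v ∈ a} k)}))

/-- The quotient map `k[t_v | v ∈ a] → A⁰(a)`. -/
def simplexMk (a : Finset E) : MvPolynomial {v // v ∈ a} k →ₐ[k] SimplexFun k a :=
  Ideal.Quotient.mkₐ k _

/-- The barycentric coordinate `t_v` on the simplex `a`; it is `0` if `v ∉ a`. -/
def coord (a : Finset E) (v : E) : SimplexFun k a :=
  open Classical in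
  if h : v ∈ a then simplexMk k a (MvPolynomial.X ⟨v, h⟩) else 0

theorem sum_coord_of_subset {a b : Finset E} (h : b ⊆ a) :
    ∑ v : {v // v ∈ a}, coord k b v = 1 := by
  classical
  have h1 : ∑ v ∈ a, coord k b v = ∑ v ∈ b, coord k b v :=
    (Finset.sum_subset h fun v _ hv => by simp [coord, hv]).symm
  have h2 : ∀ v : {v // v ∈ b}, coord k b v = simplexMk k b (MvPolynomial.X v) :=
    fun v => by simp [coord, v.2]
  have h3 : ∑ v ∈ b, coord k b v = ∑ v : {v // v ∈ b}, coord k b v :=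
    (Finset.sum_attach b (coord k b)).symm
  calc ∑ v : {v // v ∈ a}, coord k b v = ∑ v ∈ a, coord k b v := Finset.sum_attach a (coord k b)
    _ = simplexMk k b (∑ v, MvPolynomial.X v) := by rw [h1, h3, map_sum]; simp only [h2]
    _ = simplexMk k b 1 := Ideal.Quotient.eq.2 (Ideal.subset_span rfl)
    _ = 1 := map_one _

/-- For simplices `b ⊆ a`, the restriction `A⁰(a) → A⁰(b)`, with `t_v ↦ t_v` for `v ∈ b` and
`t_v ↦ 0` for `v ∉ b`. -/
def simplexRes {a b : Finset E} (h : b ⊆ a) : SimplexFun k a →ₐ[k] SimplexFun k b :=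
  Ideal.Quotient.liftₐ _ (MvPolynomial.aeval fun v : {v // v ∈ a} => coord k b v) (by
    intro p hp
    refine (Ideal.span_le (I := RingHom.ker
      (MvPolynomial.aeval (R := k) fun v : {v // v ∈ a} => coord k b v))).2 ?_ hp
    rintro _ rfl
    rw [SetLike.mem_coe, RingHom.mem_ker, map_sub, map_sum, map_one, sub_eq_zero]
    simp only [MvPolynomial.aeval_X]
    exact sum_coord_of_subset k h)

/-- The families `(f_a)_{a ∈ Y}` of elements `f_a ∈ A⁰(a)` with `f_a|_b = f_b` for all simplices
`b ⊆ a` of `Y`, as a subalgebra of the product. -/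
def polyFun (Y : PreAbstractSimplicialComplex E) :
    Subalgebra k (∀ a : {a : Finset E // a ∈ Y}, SimplexFun k a.1) where
  carrier := {f | ∀ (a b : {a : Finset E // a ∈ Y}) (h : b.1 ⊆ a.1), simplexRes k h (f a) = f b}
  mul_mem' hf hg a b h := by simp only [Pi.mul_apply, map_mul, hf a b h, hg a b h]
  add_mem' hf hg a b h := by simp only [Pi.add_apply, map_add, hf a b h, hg a b h]
  algebraMap_mem' r a b h := by simp only [Pi.algebraMap_apply, AlgHom.commutes]

/-- The algebra `A⁰(Y)` of polynomial functions on a simplicial complex `Y`. The complex `Y` is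
given by its set of simplices; its vertices are the `v` with `{v} ∈ Y`. -/
def PolyFun (Y : PreAbstractSimplicialComplex E) : Type _ := polyFun k Y

instance (Y : PreAbstractSimplicialComplex E) : CommRing (PolyFun k Y) :=
  inferInstanceAs (CommRing (polyFun k Y))

instance (Y : PreAbstractSimplicialComplex E) : Algebra k (PolyFun k Y) :=
  inferInstanceAs (Algebra k (polyFun k Y))

/-- The restriction `A⁰(Y) → A⁰(Z)` to a subcomplex `Z` of `Y`. -/
def polyRes {Y Z : PreAbstractSimplicialComplex E} (h : Z ≤ Y) :
    PolyFun k Y →ₐ[k] PolyFun k Z where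
  toFun f := ⟨fun a => f.1 ⟨a.1, h a.2⟩, fun a b hab => f.2 ⟨a.1, h a.2⟩ ⟨b.1, h b.2⟩ hab⟩
  map_one' := rfl
  map_mul' _ _ := rfl
  map_zero' := rfl
  map_add' _ _ := rfl
  commutes' _ := rfl

/-- The space `Ω^q(Y)` of algebraic `q`-forms of the algebra `A⁰(Y)`. -/
def Forms (q : ℕ) (Y : PreAbstractSimplicialComplex E) : Type _ := AlgForms k (PolyFun k Y) q

instance (q : ℕ) (Y : PreAbstractSimplicialComplex E) : AddCommGroup (Forms k q Y) :=
  inferInstanceAs (AddCommGroup (AlgForms k (PolyFun k Y) q))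

instance (q : ℕ) (Y : PreAbstractSimplicialComplex E) : Module k (Forms k q Y) :=
  inferInstanceAs (Module k (AlgForms k (PolyFun k Y) q))

/-- The restriction `Ω^q(Y) → Ω^q(Z)` to a subcomplex `Z` of `Y`. -/
def formRes (q : ℕ) {Y Z : PreAbstractSimplicialComplex E} (h : Z ≤ Y) :
    Forms k q Y →ₗ[k] Forms k q Z :=
  algFormsMap (polyRes k h) q

theorem formRes_self (q : ℕ) {Y : PreAbstractSimplicialComplex E} (h : Y ≤ Y) (ω : Forms k q Y) :
    formRes k q h ω = ω :=
  LinearMap.congr_fun (algFormsMap_id (k := k) (A := PolyFun k Y) q) ω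

theorem formRes_formRes (q : ℕ) {Y Z W : PreAbstractSimplicialComplex E} (h : Z ≤ Y) (h' : W ≤ Z)
    (ω : Forms k q Y) : formRes k q h' (formRes k q h ω) = formRes k q (h'.trans h) ω :=
  (LinearMap.congr_fun (algFormsMap_comp (polyRes k h') (polyRes k h) q) ω).symm

end PolynomialFunctions

/-! ## The Čech-type complex of the stars -/

section Cech

variable {E : Type*}

/-- The star `St u` of a sequence of vertices `u`: the smallest subcomplex of `X` that contains all
simplices of `X` containing the vertices `u_i`, see `star_isLeast`. -/
def star (X : AbstractSimplicialComplex E) {n : ℕ} (u : Fin n → E) :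
    PreAbstractSimplicialComplex E where
  faces := {s | s.Nonempty ∧ ∃ t ∈ X, s ⊆ t ∧ ∀ i, u i ∈ t}
  isRelLowerSet_faces := fun _ ⟨hs, t, ht, hst, hu⟩ =>
    ⟨hs, fun _ hr hr' => ⟨hr', t, ht, hr.trans hst, hu⟩⟩

theorem star_isLeast (X : AbstractSimplicialComplex E) {n : ℕ} (u : Fin n → E) :
    IsLeast {Y : PreAbstractSimplicialComplex E |
      Y ≤ X.toPreAbstractSimplicialComplex ∧ ∀ t ∈ X, (∀ i, u i ∈ t) → t ∈ Y} (star X u) := by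
  refine ⟨⟨?_, ?_⟩, ?_⟩
  · rintro s ⟨hs, t, ht, hst, -⟩
    exact (X.isRelLowerSet_faces ht).2 hst hs
  · exact fun t ht hu => ⟨(X.isRelLowerSet_faces ht).1, t, ht, subset_rfl, hu⟩
  · rintro Y ⟨-, hY⟩ s ⟨hs, t, ht, hst, hu⟩
    exact (Y.isRelLowerSet_faces (hY t ht hu)).2 hst hs

theorem star_le (X : AbstractSimplicialComplex E) {n : ℕ} (u : Fin n → E) :
    star X u ≤ X.toPreAbstractSimplicialComplex :=
  (star_isLeast X u).1.1

theorem star_le_star_comp (X : AbstractSimplicialComplex E) {m n : ℕ} (u : Fin n → E)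
    (f : Fin m → Fin n) : star X u ≤ star X (u ∘ f) :=
  fun _ ⟨hs, t, ht, hst, hu⟩ => ⟨hs, t, ht, hst, fun i => hu (f i)⟩

variable (k : Type*) [Field k]

/-- The space `C^{p,q}` for `p = n - 1 ≥ -1`: families `(ω_u)` of forms `ω_u ∈ Ω^q(St u)`, indexed
by the sequences `u = (u_0, …, u_p)` of `n = p + 1` vertices of `X`, with `ω_{σu} = sgn(σ) ω_u` for
all permutations `σ`. As `St (σu) = St u`, the restriction of `ω_{σu}` to `St u` is `ω_{σu}`
itself. -/
def cochains (X : AbstractSimplicialComplex E) (q n : ℕ) :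
    Submodule k (∀ u : Fin n → E, Forms k q (star X u)) where
  carrier := {ω | ∀ (σ : Equiv.Perm (Fin n)) (u : Fin n → E),
    formRes k q (star_le_star_comp X u σ) (ω (u ∘ σ)) = (Equiv.Perm.sign σ : ℤ) • ω u}
  add_mem' hω hη σ u := by simp only [Pi.add_apply, map_add, smul_add, hω σ u, hη σ u]
  zero_mem' σ u := by simp
  smul_mem' c ω hω σ u := by
    simp only [Pi.smul_apply, map_smul, hω σ u, smul_comm c]

/-- The formula `(δω)_s = ∑ i, (-1)^i ω_{∂ᵢs}|_{St s}`, where `∂ᵢs` omits the entry `s_i`. -/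
def deltaFun (X : AbstractSimplicialComplex E) (q n : ℕ) :
    (∀ u : Fin n → E, Forms k q (star X u)) →ₗ[k]
      (∀ s : Fin (n + 1) → E, Forms k q (star X s)) :=
  LinearMap.pi fun s => ∑ i : Fin (n + 1), (-1 : ℤ) ^ (i : ℕ) •
    (formRes k q (star_le_star_comp X s i.succAbove) ∘ₗ LinearMap.proj (s ∘ i.succAbove))

theorem deltaFun_apply (X : AbstractSimplicialComplex E) (q n : ℕ)
    (ω : ∀ u : Fin n → E, Forms k q (star X u)) (s : Fin (n + 1) → E) :
    deltaFun k X q n ω s = ∑ i : Fin (n + 1), (-1 : ℤ) ^ (i : ℕ) •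
      formRes k q (star_le_star_comp X s i.succAbove) (ω (s ∘ i.succAbove)) := by
  simp [deltaFun]

/-- Permuting a sequence and omitting its `i`-th entry is omitting the `σ i`-th entry and then
permuting, with the expected change of sign. -/
theorem exists_perm_succAbove {n : ℕ} (σ : Equiv.Perm (Fin (n + 1))) (i : Fin (n + 1)) :
    ∃ e : Equiv.Perm (Fin n), σ ∘ i.succAbove = (σ i).succAbove ∘ e ∧
      (-1 : ℤ) ^ (i : ℕ) * (Equiv.Perm.sign e : ℤ) =
        (Equiv.Perm.sign σ : ℤ) * (-1) ^ (σ i : ℕ) := by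
  set τ : Equiv.Perm (Fin (n + 1)) := (σ i).cycleRange * σ * i.cycleRange⁻¹ with hτ
  have h0 : τ 0 = 0 := by
    simp [hτ, Equiv.Perm.inv_def, Fin.cycleRange_symm_zero]
  obtain ⟨⟨p, e⟩, he⟩ := Equiv.Perm.decomposeFin.symm.surjective τ
  have hp : p = 0 := by
    rw [← h0, ← he, Equiv.Perm.decomposeFin_symm_apply_zero]
  subst hp
  have hsucc : ∀ j, τ (Fin.succ j) = Fin.succ (e j) := fun j => by
    rw [← he, Equiv.Perm.decomposeFin_symm_apply_succ]; simp
  refine ⟨e, ?_, ?_⟩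
  · funext j
    have h1 := hsucc j
    simp only [hτ, Equiv.Perm.mul_apply, Equiv.Perm.inv_def, Fin.cycleRange_symm_succ] at h1
    rw [← Equiv.eq_symm_apply, Fin.cycleRange_symm_succ] at h1
    exact h1
  · have h2 : Equiv.Perm.sign e = (-1) ^ (σ i : ℕ) * Equiv.Perm.sign σ * (-1) ^ (i : ℕ) := by
      have h3 := Equiv.Perm.decomposeFin.symm_sign (0 : Fin (n + 1)) e
      rw [he, hτ] at h3
      simpa [Fin.sign_cycleRange] using h3.symm
    have h4 : (-1 : ℤ) ^ (i : ℕ) * (-1) ^ (i : ℕ) = 1 := by rw [← mul_pow]; simp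
    rw [h2]
    push_cast
    linear_combination ((-1 : ℤ) ^ (σ i : ℕ) * (Equiv.Perm.sign σ : ℤ)) * h4

theorem formRes_congr {X : AbstractSimplicialComplex E} {q n : ℕ}
    {ω : ∀ u : Fin n → E, Forms k q (star X u)} {u u' : Fin n → E} (huu' : u = u')
    {Y : PreAbstractSimplicialComplex E} (h : Y ≤ star X u) (h' : Y ≤ star X u') :
    formRes k q h (ω u) = formRes k q h' (ω u') := by
  subst huu'; rfl

theorem deltaFun_mem (X : AbstractSimplicialComplex E) (q n : ℕ)
    {ω : ∀ u : Fin n → E, Forms k q (star X u)} (hω : ω ∈ cochains k X q n) :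
    deltaFun k X q n ω ∈ cochains k X q (n + 1) := by
  intro σ s
  simp only [deltaFun_apply, map_sum, map_zsmul, formRes_formRes, Finset.smul_sum, smul_smul]
  rw [← Equiv.sum_comp σ (fun i => ((Equiv.Perm.sign σ : ℤ) * (-1) ^ (i : ℕ)) •
    formRes k q (star_le_star_comp X s i.succAbove) (ω (s ∘ i.succAbove)))]
  refine Finset.sum_congr rfl fun i _ => ?_
  obtain ⟨e, he, hsign⟩ := exists_perm_succAbove σ i
  have h1 : (s ∘ σ) ∘ i.succAbove = (s ∘ (σ i).succAbove) ∘ e := by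
    rw [Function.comp_assoc, he, Function.comp_assoc]
  have h2 := map_zsmul (formRes k q (star_le_star_comp X s (σ i).succAbove))
    (Equiv.Perm.sign e : ℤ) (ω (s ∘ (σ i).succAbove))
  rw [← hω e (s ∘ (σ i).succAbove), formRes_formRes] at h2
  rw [← hsign, mul_smul, ← h2]
  exact congrArg _ (formRes_congr k h1 _ _)

/-- The differential `δ : C^{p,q} → C^{p+1,q}` for `p = n - 1 ≥ -1`. -/
def delta (X : AbstractSimplicialComplex E) (q n : ℕ) :
    cochains k X q n →ₗ[k] cochains k X q (n + 1) :=
  (deltaFun k X q n).restrict fun _ hω => deltaFun_mem k X q n hω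

/-- The identification of `Ω^q(X)` with `C^{-1,q}`: the only sequence of no vertices is the empty
one, and its star is `X`. -/
def formsToCochains (X : AbstractSimplicialComplex E) (q : ℕ) :
    Forms k q X.toPreAbstractSimplicialComplex →ₗ[k] cochains k X q 0 :=
  LinearMap.codRestrict _ (LinearMap.pi fun u => formRes k q (star_le X u)) fun ω σ u => by
    have : σ = 1 := Subsingleton.elim _ _
    subst this
    change formRes k q _ (formRes k q _ ω) = _ • formRes k q _ ω
    rw [formRes_formRes]
    simp

end Cech

end PolyForms

end

/-! The stars of the vertices behave like an open cover, and the complex is contracted with a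
partition of unity. On `St u` the coordinate `t_v` vanishes on every simplex without `v`, and
simplices with `v` lie in `St (v, u)`. So `t_v` kills the kernel `I` of the restriction of functions
from `St u` to `St (v, u)`. For `a` in `I` this gives `0 = t_v d(t_v a) = t_v² da`. As that
restriction is surjective, multiplication by `t_v²` on forms on `St u` factors through forms on `St
(v, u)` (`exists_algForms_extension`); this is extension by zero, `vertexExt`.

Surjectivity holds because the coordinates generate the functions on a finite complex in which every
simplex lies in one containing `v` (`aeval_polyCoord_surjective`).

Since the `t_v` sum to `1`, their squares also generate the unit ideal: `∑ g_v t_v² = 1` for some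
`g_v` (`exists_sum_mul_sq_polyCoord`). Then `(hω)_u = ∑ g_v t_v² ω_{(v,u)}` preserves alternation
and satisfies `hδ + δh = id`, with only the term `hδ` on `C^{-1,q}`. -/

noncomputable section

namespace PolyForms

/-! ## Forms killed by restriction along a surjection -/

/-- A module killed by the kernel of a surjection `A → B` is a `B`-module. -/
theorem exists_module_of_surjective {A B T : Type*} [CommRing A] [CommRing B] (φ : A →+* B)
    (hφ : Function.Surjective φ) [AddCommGroup T] [Module A T]
    (hT : ∀ a : A, φ a = 0 → ∀ x : T, a • x = 0) :
    ∃ _ : Module B T, ∀ (a : A) (x : T), φ a • x = a • x := by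
  let _ : SMul B T := ⟨fun b x => Function.surjInv hφ b • x⟩
  have h : ∀ (a : A) (x : T), φ a • x = a • x := fun a x => by
    change Function.surjInv hφ (φ a) • x = a • x
    rw [← sub_eq_zero, ← sub_smul]
    exact hT _ (by rw [map_sub, Function.surjInv_eq hφ, sub_self]) x
  exact ⟨hφ.moduleLeft φ h, h⟩

section Extension

variable {k A B : Type*} [Field k] [CommRing A] [Algebra k A] [CommRing B] [Algebra k B]

/-- For `a` in the kernel, `0 = t d(ta) = t² da + ta dt = t² da`, so `b ↦ t² d(lift of b)` is a
well-defined derivation of `B`. Its values lie in `t² Ω[A⁄k]`, which is a `B`-module because `t`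
kills the kernel. The induced linear map on `Ω[B⁄k]` recovers multiplication by `t²`. -/
theorem sq_smul_eq_zero_of_map_eq_zero [Algebra A B] [IsScalarTower k A B]
    (hs : Function.Surjective (algebraMap A B)) (t : A)
    (ht : ∀ a, algebraMap A B a = 0 → t * a = 0) (ω : Ω[A⁄k])
    (hω : KaehlerDifferential.map k k A B ω = 0) : t ^ 2 • ω = 0 := by
  let T : Submodule A Ω[A⁄k] := LinearMap.range (LinearMap.lsmul A Ω[A⁄k] (t ^ 2))
  have hT : ∀ a : A, algebraMap A B a = 0 → ∀ x : T, a • x = 0 := by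
    rintro a ha ⟨_, y, rfl⟩
    ext
    change a • t ^ 2 • y = 0
    rw [smul_smul, show a * t ^ 2 = t * (t * a) by ring, ht a ha, mul_zero, zero_smul]
  obtain ⟨_, hm⟩ := exists_module_of_surjective (algebraMap A B) hs hT
  have htow : IsScalarTower k B T := ⟨fun c b x => by
    obtain ⟨a, rfl⟩ := hs b
    rw [hm]
    refine Eq.trans ?_ ((hm (c • a) x).trans (smul_assoc c a x))
    exact congrArg (· • x) ((Algebra.linearMap A B).map_smul_of_tower c a).symm⟩
  let m : Ω[A⁄k] →ₗ[A] T := (LinearMap.lsmul A Ω[A⁄k] (t ^ 2)).rangeRestrict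
  have hmD : ∀ a, algebraMap A B a = 0 → m (KaehlerDifferential.D k A a) = 0 := fun a ha => by
    ext
    change t ^ 2 • KaehlerDifferential.D k A a = 0
    have h : t • KaehlerDifferential.D k A (t * a) = 0 := by rw [ht a ha, map_zero, smul_zero]
    rwa [Derivation.leibniz, smul_add, smul_smul, smul_smul, ht a ha, zero_smul, add_zero,
      ← pow_two] at h
  have hwd : ∀ a a', algebraMap A B a = algebraMap A B a' →
      m (KaehlerDifferential.D k A a) = m (KaehlerDifferential.D k A a') := fun a a' h => by
    rw [← sub_eq_zero, ← map_sub, ← map_sub]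
    exact hmD _ (by rw [map_sub, h, sub_self])
  let σ := Function.surjInv hs
  have hσ : ∀ b, algebraMap A B (σ b) = b := Function.surjInv_eq hs
  let d : Derivation k B T := Derivation.mk'
    { toFun := fun b => m (KaehlerDifferential.D k A (σ b))
      map_add' := fun b b' => by
        rw [← map_add, ← map_add]
        exact hwd _ _ (by simp [hσ])
      map_smul' := fun c b => by
        rw [RingHom.id_apply, hwd (σ (c • b)) (c • σ b) (by
          rw [hσ]
          exact (((Algebra.linearMap A B).map_smul_of_tower c (σ b)).trans
            (congrArg (c • ·) (hσ b))).symm), Derivation.map_smul]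
        exact map_smul (m.restrictScalars k) c _ } (fun b b' => by
      change m (KaehlerDifferential.D k A (σ (b * b'))) =
        b • m (KaehlerDifferential.D k A (σ b')) + b' • m (KaehlerDifferential.D k A (σ b))
      rw [hwd (σ (b * b')) (σ b * σ b') (by simp [hσ]), Derivation.leibniz, map_add, map_smul,
        map_smul, ← hm, ← hm, hσ, hσ])
  have hL : ∀ ω : Ω[A⁄k], d.liftKaehlerDifferential (KaehlerDifferential.map k k A B ω) = m ω := by
    intro ω
    have hω : ω ∈ Submodule.span A (Set.range (KaehlerDifferential.D k A)) := by
      rw [KaehlerDifferential.span_range_derivation]; trivial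
    induction hω using Submodule.span_induction with
    | mem x hx =>
      obtain ⟨a, rfl⟩ := hx
      rw [KaehlerDifferential.map_D, Derivation.liftKaehlerDifferential_comp_D]
      exact hwd _ _ (hσ _)
    | zero => simp
    | add x y _ _ hx hy => simp only [map_add, hx, hy]
    | smul a x _ hx =>
      rw [LinearMap.map_smul, m.map_smul, ← hx, ← algebraMap_smul B a, LinearMap.map_smul, hm]
  have h := hL ω
  rw [hω, map_zero] at h
  exact (congrArg Subtype.val h).symm

/-- A multiple of a multilinear map that kills the kernel of `π` in each argument depends only on
the images of the arguments under `π`. -/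
theorem multilinear_congr_of_ker {M N P ι : Type*} [Finite ι] [AddCommGroup M] [Module A M]
    [AddCommGroup N] [Module A N] [AddCommGroup P] [Module A P]
    (f : MultilinearMap A (fun _ : ι => M) P) (π : M →ₗ[A] N)
    (hf : ∀ (m : ι → M) (i : ι), π (m i) = 0 → f m = 0) {x y : ι → M}
    (h : ∀ i, π (x i) = π (y i)) : f x = f y := by
  classical
  have := Fintype.ofFinite ι
  -- The arguments are exchanged one at a time; each exchange alters `f` by a value with one
  -- argument in the kernel of `π`.
  suffices H : ∀ s : Finset ι, f (s.piecewise x y) = f y by simpa using H Finset.univ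
  intro s
  induction s using Finset.induction_on with
  | empty => simp
  | insert i s _ ih =>
    rw [Finset.piecewise_insert, ← ih, ← sub_eq_zero]
    by_cases hi : i ∈ s
    · rw [show x i = s.piecewise x y i by simp [hi], Function.update_eq_self, sub_self]
    · nth_rw 2 [← Function.update_eq_self i (s.piecewise x y)]
      rw [← f.map_update_sub]
      exact hf _ i (by simp [hi, h])

/-- If `φ : A → B` is surjective and `t` kills its kernel, then multiplication by `t²` on `Ω^q_A`
factors through `Ω^q_B`. -/
theorem exists_algForms_extension (φ : A →ₐ[k] B) (hφ : Function.Surjective φ) (t : A)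
    (ht : ∀ a, φ a = 0 → t * a = 0) (q : ℕ) :
    ∃ e : AlgForms k B q →ₗ[k] AlgForms k A q, ∀ ω, e (algFormsMap φ q ω) = t ^ 2 • ω := by
  let _ : Algebra A B := φ.toRingHom.toAlgebra
  have _ : IsScalarTower k A B := IsScalarTower.of_algHom φ
  let π : Ω[A⁄k] →ₗ[A] Ω[B⁄k] := KaehlerDifferential.map k k A B
  have hπ : Function.Surjective π :=
    KaehlerDifferential.map_surjective_of_surjective k k A B hφ
  -- The target is `t² Ω^q_A` because the kernel of `φ` kills it, making it a `B`-module, as the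
  -- universal property of `Ω^q_B` requires.
  let T : Submodule A (AlgForms k A q) := LinearMap.range (LinearMap.lsmul A _ (t ^ 2))
  have hT : ∀ a : A, φ.toRingHom a = 0 → ∀ x : T, a • x = 0 := by
    rintro a ha ⟨_, y, rfl⟩
    ext1
    change a • t ^ 2 • y = 0
    rw [smul_smul, show a * t ^ 2 = t * (t * a) by ring, ht a ha, mul_zero, zero_smul]
  obtain ⟨_, hm⟩ := exists_module_of_surjective (T := T) φ.toRingHom hφ hT
  have htow : IsScalarTower k B T := ⟨fun c b x => by
    obtain ⟨a, rfl⟩ := hφ b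
    have h1 := hm (c • a) x
    have h2 := hm a x
    simp only [AlgHom.toRingHom_eq_coe, RingHom.coe_coe] at h1 h2
    rw [← map_smul, h1, h2, smul_assoc]⟩
  let m : AlgForms k A q →ₗ[A] T := (LinearMap.lsmul A _ (t ^ 2)).rangeRestrict
  let f : MultilinearMap A (fun _ : Fin q => Ω[A⁄k]) T :=
    m.compMultilinearMap (exteriorPower.ιMulti A q (M := Ω[A⁄k])).toMultilinearMap
  -- A single factor `t²` suffices for every `q`: it can be moved into the one argument that lies in
  -- the kernel.
  have hf : ∀ (x : Fin q → Ω[A⁄k]) (i : Fin q), π (x i) = 0 → f x = 0 := by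
    intro x i hx
    ext1
    change t ^ 2 • exteriorPower.ιMulti A q x = 0
    rw [← Function.update_eq_self i x, ← AlternatingMap.map_update_smul,
      sq_smul_eq_zero_of_map_eq_zero hφ t ht (x i) hx]
    exact AlternatingMap.map_coord_zero _ i (by simp)
  have hwd {x y : Fin q → Ω[A⁄k]} (h : ∀ i, π (x i) = π (y i)) : f x = f y :=
    multilinear_congr_of_ker (P := T) f π hf h
  let σ := Function.surjInv hπ
  have hσ : ∀ b, π (σ b) = b := Function.surjInv_eq hπ
  have hup (x : Fin q → Ω[B⁄k]) (i : Fin q) (y : Ω[B⁄k]) (z : Ω[A⁄k]) (hz : π z = y)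
      [DecidableEq (Fin q)] :
      f (fun j => σ (Function.update x i y j)) = f (Function.update (fun j => σ (x j)) i z) := by
    refine hwd fun j => ?_
    rw [hσ]
    by_cases hj : j = i
    · subst hj; simp [hz]
    · simp [hj, hσ]
  let g : Ω[B⁄k] [⋀^Fin q]→ₗ[B] T :=
    { toFun := fun x => f fun i => σ (x i)
      map_update_add' := fun x i y z => by
        rw [hup x i _ (σ y + σ z) (by simp [hσ]), hup x i y _ (hσ y), hup x i z _ (hσ z),
          f.map_update_add]
      map_update_smul' := fun x i b y => by
        obtain ⟨a, rfl⟩ := hφ b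
        rw [hup x i _ (a • σ y) (by rw [map_smul, hσ]; exact (algebraMap_smul B a y).symm),
          hup x i y _ (hσ y), f.map_update_smul]
        exact (hm a _).symm
      map_eq_zero_of_eq' := fun x i j hx hij => by
        change m (exteriorPower.ιMulti A q _) = 0
        rw [(exteriorPower.ιMulti A q).map_eq_zero_of_eq _ (congrArg σ hx) hij, map_zero] }
  refine ⟨(T.subtype.restrictScalars k) ∘ₗ
    (exteriorPower.alternatingMapLinearEquiv g).restrictScalars k, fun ω => ?_⟩
  refine LinearMap.congr_fun (f := (((T.subtype.restrictScalars k) ∘ₗ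
    (exteriorPower.alternatingMapLinearEquiv g).restrictScalars k) ∘ₗ algFormsMap φ q))
    (g := (LinearMap.lsmul A (AlgForms k A q) (t ^ 2)).restrictScalars k)
    (algForms_hom_ext fun a b => ?_) ω
  rw [LinearMap.comp_apply, algFormsMap_smul_D]
  simp only [LinearMap.comp_apply, LinearMap.coe_restrictScalars, map_smul,
    exteriorPower.alternatingMapLinearEquiv_apply_ιMulti]
  change ((φ.toRingHom a • f fun i => σ (KaehlerDifferential.D k B (φ (b i))) : T) :
    AlgForms k A q) = _
  rw [hm, hwd (y := fun i => KaehlerDifferential.D k A (b i)) fun i => by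
    rw [hσ]; exact (KaehlerDifferential.map_D k k A B (b i)).symm]
  rfl

end Extension

/-! ## Polynomial functions near a vertex -/

section Vertex

variable (k : Type*) [Field k] {E : Type*}

theorem simplexRes_coord {a b : Finset E} (h : b ⊆ a) (v : E) :
    simplexRes k h (coord k a v) = coord k b v := by
  by_cases hv : v ∈ a
  · have h1 : simplexRes k h (simplexMk k a (MvPolynomial.X ⟨v, hv⟩)) =
        MvPolynomial.aeval (fun v : {v // v ∈ a} => coord k b v) (MvPolynomial.X ⟨v, hv⟩) :=
      Ideal.Quotient.liftₐ_apply ..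
    rw [MvPolynomial.aeval_X] at h1
    rw [← h1, coord, dif_pos hv]
  · rw [coord, dif_neg hv, map_zero, coord, dif_neg fun h' => hv (h h')]

theorem sum_coord (a : Finset E) : ∑ v ∈ a, coord k a v = 1 :=
  (Finset.sum_attach a (coord k a)).symm.trans (sum_coord_of_subset k subset_rfl)

/-- Algebra maps out of `A⁰(a)` are determined by their values on the coordinates. -/
theorem simplexFun_hom_ext {R : Type*} [CommRing R] [Algebra k R] {a : Finset E}
    {f g : SimplexFun k a →ₐ[k] R} (h : ∀ v ∈ a, f (coord k a v) = g (coord k a v)) : f = g := by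
  refine Ideal.Quotient.algHom_ext k (MvPolynomial.algHom_ext fun v => ?_)
  have := h v v.2
  rw [coord, dif_pos v.2] at this
  exact this

/-- The algebra map out of `A⁰(a)` with prescribed values, of sum `1`, on the coordinates. -/
theorem exists_simplexFun_hom {R : Type*} [CommRing R] [Algebra k R] {a : Finset E} (x : E → R)
    (hx : ∑ v ∈ a, x v = 1) :
    ∃ f : SimplexFun k a →ₐ[k] R, ∀ v ∈ a, f (coord k a v) = x v := by
  refine ⟨Ideal.Quotient.liftₐ _ (MvPolynomial.aeval fun v : {v // v ∈ a} => x v) ?_, ?_⟩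
  · intro p hp
    refine (Ideal.span_le (I := RingHom.ker
      (MvPolynomial.aeval (R := k) fun v : {v // v ∈ a} => x v))).2 ?_ hp
    rintro _ rfl
    rw [SetLike.mem_coe, RingHom.mem_ker, map_sub, map_sum, map_one, sub_eq_zero]
    simp only [MvPolynomial.aeval_X]
    exact (Finset.sum_attach a x).trans hx
  · intro v hv
    rw [coord, dif_pos hv]
    exact (Ideal.Quotient.liftₐ_apply ..).trans (MvPolynomial.aeval_X _ _)

/-- For a vertex `v` of `a`, the restriction from polynomials in all coordinates to `A⁰(a)` has a
section, such that restricting it further to another simplex `b` with vertex `v` only depends on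
the restriction to `a ∩ b`. -/
theorem exists_simplexFun_section [DecidableEq E] {a : Finset E} {v : E} (hv : v ∈ a) :
    ∃ s : SimplexFun k a →ₐ[k] MvPolynomial E k,
      (∀ f, MvPolynomial.aeval (coord k a) (s f) = f) ∧
      ∀ b : Finset E, v ∈ b → ∀ f,
        simplexRes k (Finset.inter_subset_left : a ∩ b ⊆ a) f = 0 →
          MvPolynomial.aeval (coord k b) (s f) = 0 := by
  -- The section eliminates `t_v`, replacing it by `1` minus the other coordinates of `a`.
  let x (R : Type _) [CommRing R] (y : E → R) (a : Finset E) (w : E) : R :=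
    if w = v then 1 - ∑ w ∈ a.erase v, y w else y w
  have hx (R : Type _) [CommRing R] (y : E → R) (a : Finset E) (hv : v ∈ a) :
      ∑ w ∈ a, x R y a w = 1 := by
    rw [← Finset.add_sum_erase a _ hv]
    have : ∑ w ∈ a.erase v, x R y a w = ∑ w ∈ a.erase v, y w :=
      Finset.sum_congr rfl fun w hw => if_neg (Finset.ne_of_mem_erase hw)
    rw [this]
    simp [x]
  obtain ⟨s, hs⟩ := exists_simplexFun_hom k (x (MvPolynomial E k) MvPolynomial.X a) (hx _ _ a hv)
  refine ⟨s, fun f => ?_, fun b hb f hf => ?_⟩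
  · refine DFunLike.congr_fun (f := (MvPolynomial.aeval (coord k a)).comp s)
      (g := AlgHom.id k _) (simplexFun_hom_ext k fun w hw => ?_) f
    rw [AlgHom.comp_apply, hs w hw, AlgHom.id_apply]
    by_cases h : w = v
    · subst h
      simp only [x, if_true, map_sub, map_one, map_sum, MvPolynomial.aeval_X]
      rw [sub_eq_iff_eq_add, Finset.add_sum_erase _ _ hv, sum_coord]
    · simp [x, h]
  · have hvab : v ∈ a ∩ b := Finset.mem_inter.2 ⟨hv, hb⟩
    obtain ⟨j, hj⟩ := exists_simplexFun_hom k (a := a ∩ b) (x _ (coord k b) (a ∩ b))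
      (hx _ _ _ hvab)
    -- Coordinates outside `b` vanish on `b`, so evaluating the section on `b` only sees the
    -- coordinates of `a ∩ b`.
    have hcomp : (MvPolynomial.aeval (coord k b)).comp s =
        j.comp (simplexRes k (Finset.inter_subset_left : a ∩ b ⊆ a)) := by
      refine simplexFun_hom_ext k fun w hw => ?_
      rw [AlgHom.comp_apply, AlgHom.comp_apply, hs w hw, simplexRes_coord]
      by_cases h : w = v
      · subst h
        rw [hj w hvab]
        simp only [x, if_true, map_sub, map_one, map_sum, MvPolynomial.aeval_X]
        congr 1
        refine (Finset.sum_subset (Finset.erase_subset_erase _ Finset.inter_subset_left) ?_).symm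
        intro y hy hy'
        rw [coord, dif_neg]
        intro hyb
        simp only [Finset.mem_erase, Finset.mem_inter] at hy hy'
        tauto
      · by_cases hwb : w ∈ b
        · rw [hj w (Finset.mem_inter.2 ⟨hw, hwb⟩)]
          simp [x, h]
        · simp [x, h, coord, hwb]
    have := DFunLike.congr_fun hcomp f
    rw [AlgHom.comp_apply, AlgHom.comp_apply, hf, map_zero] at this
    exact this

variable {Y Z : PreAbstractSimplicialComplex E}

/-- The value of a polynomial function on a simplex. -/
def polyEval (a : {a : Finset E // a ∈ Y}) : PolyFun k Y →ₐ[k] SimplexFun k a.1 :=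
  (Pi.evalAlgHom k (fun a : {a : Finset E // a ∈ Y} => SimplexFun k a.1) a).comp (polyFun k Y).val

variable {k} in
theorem polyFun_ext {f g : PolyFun k Y} (h : ∀ a, polyEval k a f = polyEval k a g) : f = g :=
  Subtype.ext (funext h)

variable {k} in
theorem simplexRes_polyEval {a b : {a : Finset E // a ∈ Y}} (h : b.1 ⊆ a.1) (f : PolyFun k Y) :
    simplexRes k h (polyEval k a f) = polyEval k b f :=
  f.2 a b h

variable (Y) in
/-- The barycentric coordinate `t_v` on a simplicial complex. -/
def polyCoord (v : E) : PolyFun k Y :=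
  ⟨fun a => coord k a.1 v, fun _ _ h => simplexRes_coord k h v⟩

theorem polyRes_polyCoord (h : Z ≤ Y) (v : E) :
    polyRes k h (polyCoord k Y v) = polyCoord k Z v := rfl

theorem sum_polyCoord [Fintype E] : ∑ v, polyCoord k Y v = 1 := by
  refine polyFun_ext fun a => ?_
  rw [map_sum, map_one, ← sum_coord k a.1]
  exact (Finset.sum_subset (Finset.subset_univ _) fun v _ hv =>
    dif_neg hv).symm

/-- Coordinates generate the polynomial functions on a finite complex, all of whose maximal
simplices have a common vertex. -/
theorem aeval_polyCoord_surjective [Finite E] (v : E)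
    (hv : ∀ a ∈ Z, ∃ b ∈ Z, a ⊆ b ∧ v ∈ b) :
    Function.Surjective (MvPolynomial.aeval (R := k) (polyCoord k Z)) := by
  classical
  intro f
  have heval (a : {a : Finset E // a ∈ Z}) (p : MvPolynomial E k) :
      polyEval k a (MvPolynomial.aeval (polyCoord k Z) p) = MvPolynomial.aeval (coord k a.1) p := by
    rw [← AlgHom.comp_apply, MvPolynomial.comp_aeval]
    rfl
  -- To add a simplex `c` to `S`, the error on `c` is lifted by the section. The error already
  -- vanishes on the earlier simplices `a`, hence on `c ∩ a`, so the correction leaves the values on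
  -- `a` unchanged.
  have key : ∀ S : Finset (Finset E), ∃ p : MvPolynomial E k,
      ∀ a : {a : Finset E // a ∈ Z}, a.1 ∈ S → v ∈ a.1 →
        polyEval k a (MvPolynomial.aeval (polyCoord k Z) p) = polyEval k a f := by
    intro S
    induction S using Finset.induction_on with
    | empty => exact ⟨0, by simp⟩
    | insert c S _ ih =>
      obtain ⟨p, hp⟩ := ih
      by_cases hc : c ∈ Z ∧ v ∈ c
      · obtain ⟨hcZ, hvc⟩ := hc
        obtain ⟨s, hs, hs'⟩ := exists_simplexFun_section k hvc
        let g := f - MvPolynomial.aeval (polyCoord k Z) p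
        refine ⟨p + s (polyEval k ⟨c, hcZ⟩ g), fun a ha hva => ?_⟩
        rw [map_add, map_add, heval a (s _)]
        rcases Finset.mem_insert.1 ha with rfl | ha
        · rw [hs, ← map_add, add_sub_cancel]
        · rw [hs' a.1 hva, add_zero, hp a ha hva]
          have hca : c ∩ a.1 ∈ Z := (Z.isRelLowerSet_faces hcZ).2 Finset.inter_subset_left
            ⟨v, Finset.mem_inter.2 ⟨hvc, hva⟩⟩
          rw [simplexRes_polyEval (a := ⟨c, hcZ⟩) (b := ⟨c ∩ a.1, hca⟩) Finset.inter_subset_left,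
            ← simplexRes_polyEval (a := a) (b := ⟨c ∩ a.1, hca⟩) Finset.inter_subset_right,
            map_sub, hp a ha hva, sub_self, map_zero]
      · refine ⟨p, fun a ha hva => hp a ?_ hva⟩
        rcases Finset.mem_insert.1 ha with h | h
        · exact absurd ⟨h ▸ a.2, h ▸ hva⟩ hc
        · exact h
  have := Fintype.ofFinite E
  obtain ⟨p, hp⟩ := key Finset.univ
  refine ⟨p, polyFun_ext fun a => ?_⟩
  obtain ⟨b, hb, hab, hvb⟩ := hv a.1 a.2
  rw [← simplexRes_polyEval (a := ⟨b, hb⟩) (b := a) hab,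
    ← simplexRes_polyEval (a := ⟨b, hb⟩) (b := a) hab, hp ⟨b, hb⟩ (Finset.mem_univ _) hvb]

theorem polyRes_surjective [Finite E] (h : Z ≤ Y) (v : E)
    (hv : ∀ a ∈ Z, ∃ b ∈ Z, a ⊆ b ∧ v ∈ b) : Function.Surjective (polyRes k h) := by
  intro f
  obtain ⟨p, rfl⟩ := aeval_polyCoord_surjective k v hv f
  refine ⟨MvPolynomial.aeval (polyCoord k Y) p, ?_⟩
  rw [← AlgHom.comp_apply, MvPolynomial.comp_aeval]
  rfl

-- On a simplex without `v` the coordinate vanishes; a simplex with `v` lies in `Z`, where `f`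
-- vanishes.
variable {k} in
theorem polyCoord_mul_eq_zero (h : Z ≤ Y) (v : E) (hv : ∀ a ∈ Y, v ∈ a → a ∈ Z) (f : PolyFun k Y)
    (hf : polyRes k h f = 0) : polyCoord k Y v * f = 0 := by
  refine polyFun_ext fun a => ?_
  rw [map_mul, map_zero]
  by_cases hva : v ∈ a.1
  · have : polyEval k a f = polyEval k ⟨a.1, hv a.1 a.2 hva⟩ (polyRes k h f) := rfl
    rw [this, hf, map_zero, mul_zero]
  · have : polyEval k a (polyCoord k Y v) = 0 := dif_neg hva
    rw [this, zero_mul]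

/-- Powers of generators of the unit ideal still generate it. The exponent `2` is the one needed to
extend forms by zero. -/
theorem exists_sum_mul_sq_polyCoord [Fintype E] :
    ∃ g : E → PolyFun k Y, ∑ v, g v * polyCoord k Y v ^ 2 = 1 := by
  have h1 : Ideal.span (Set.range (polyCoord k Y)) = ⊤ := by
    rw [Ideal.eq_top_iff_one, ← sum_polyCoord k]
    exact sum_mem fun v _ => Ideal.subset_span ⟨v, rfl⟩
  have h2 := Ideal.span_pow_eq_top _ h1 2
  rw [← Set.range_comp, Ideal.eq_top_iff_one] at h2
  exact Ideal.mem_span_range_iff_exists_fun.1 h2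

end Vertex

/-! ## Extension of forms from the star of a vertex -/

section FormExtension

variable {k : Type*} [Field k]

theorem algFormsMap_smul {A B : Type*} [CommRing A] [Algebra k A] [CommRing B] [Algebra k B]
    (φ : A →ₐ[k] B) (q : ℕ) (a : A) (ω : AlgForms k A q) :
    algFormsMap φ q (a • ω) = φ a • algFormsMap φ q ω := by
  refine LinearMap.congr_fun
    (f := algFormsMap φ q ∘ₗ (LinearMap.lsmul A (AlgForms k A q) a).restrictScalars k)
    (g := (LinearMap.lsmul B (AlgForms k B q) (φ a)).restrictScalars k ∘ₗ algFormsMap φ q)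
    (algForms_hom_ext fun c b => ?_) ω
  simp only [LinearMap.comp_apply, LinearMap.coe_restrictScalars, LinearMap.lsmul_apply,
    algFormsMap_smul_D]
  rw [smul_smul, algFormsMap_smul_D, map_mul, smul_smul]

theorem algFormsMap_surjective {A B : Type*} [CommRing A] [Algebra k A] [CommRing B] [Algebra k B]
    (φ : A →ₐ[k] B) (hφ : Function.Surjective φ) (q : ℕ) :
    Function.Surjective (algFormsMap φ q) := by
  -- Surjectivity is phrased as the vanishing of the projection to the cokernel, so that it can be
  -- checked on the generating forms.
  have h : (LinearMap.range (algFormsMap φ q)).mkQ = 0 := algForms_hom_ext fun b c => by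
    obtain ⟨a, rfl⟩ := hφ b
    choose c' hc' using fun i => hφ (c i)
    obtain rfl : (fun i => φ (c' i)) = c := funext hc'
    rw [← algFormsMap_smul_D, LinearMap.zero_apply, Submodule.mkQ_apply,
      Submodule.Quotient.mk_eq_zero]
    exact ⟨_, rfl⟩
  rw [← LinearMap.range_eq_top, ← Submodule.ker_mkQ (LinearMap.range (algFormsMap φ q)), h,
    LinearMap.ker_zero]

variable {E : Type*}

instance (q : ℕ) (Y : PreAbstractSimplicialComplex E) : Module (PolyFun k Y) (Forms k q Y) :=
  inferInstanceAs (Module (PolyFun k Y) (AlgForms k (PolyFun k Y) q))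

theorem formRes_smul (q : ℕ) {Y Z : PreAbstractSimplicialComplex E} (h : Z ≤ Y) (f : PolyFun k Y)
    (ω : Forms k q Y) : formRes k q h (f • ω) = polyRes k h f • formRes k q h ω :=
  algFormsMap_smul (polyRes k h) q f ω

theorem star_cons_le (X : AbstractSimplicialComplex E) {n : ℕ} (v : E) (u : Fin n → E) :
    star X (Fin.cons v u : Fin (n + 1) → E) ≤ star X u :=
  star_le_star_comp X (Fin.cons v u : Fin (n + 1) → E) Fin.succ

theorem star_cons_le_star_cons_comp (X : AbstractSimplicialComplex E) {m n : ℕ} (v : E) (u : Fin n → E) (f : Fin m → Fin n) :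
    star X (Fin.cons v u : Fin (n + 1) → E) ≤
      star X (Fin.cons v (u ∘ f) : Fin (m + 1) → E) :=
  fun _ ⟨hs, t, ht, hst, hu⟩ => ⟨hs, t, ht, hst, Fin.cases (hu 0) fun i => hu (f i).succ⟩

theorem mem_star_cons {X : AbstractSimplicialComplex E} {n : ℕ} {v : E} {u : Fin n → E}
    {a : Finset E} (ha : a ∈ star X u) (hv : v ∈ a) :
    a ∈ star X (Fin.cons v u : Fin (n + 1) → E) := by
  obtain ⟨hs, t, ht, hst, hu⟩ := ha
  exact ⟨hs, t, ht, hst, Fin.cases (hst hv) hu⟩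

theorem exists_mem_star_of_mem_star_cons {X : AbstractSimplicialComplex E} {n : ℕ} {v : E}
    {u : Fin n → E} {a : Finset E} (ha : a ∈ star X (Fin.cons v u : Fin (n + 1) → E)) :
    ∃ b ∈ star X (Fin.cons v u : Fin (n + 1) → E), a ⊆ b ∧ v ∈ b := by
  obtain ⟨-, t, ht, hst, hu⟩ := ha
  exact ⟨t, ⟨⟨v, hu 0⟩, t, ht, subset_rfl, hu⟩, hst, hu 0⟩

variable [Finite E]

theorem formRes_star_cons_surjective (X : AbstractSimplicialComplex E) (q : ℕ) {n : ℕ} (v : E)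
    (u : Fin n → E) : Function.Surjective (formRes k q (star_cons_le X v u)) :=
  algFormsMap_surjective _
    (polyRes_surjective k _ v fun _ => exists_mem_star_of_mem_star_cons) q

theorem exists_vertexExt (X : AbstractSimplicialComplex E) (q : ℕ) {n : ℕ} (v : E)
    (u : Fin n → E) :
    ∃ e : Forms k q (star X (Fin.cons v u : Fin (n + 1) → E)) →ₗ[k] Forms k q (star X u),
      ∀ ω, e (formRes k q (star_cons_le X v u) ω) = polyCoord k (star X u) v ^ 2 • ω :=
  exists_algForms_extension (polyRes k (star_cons_le X v u))
    (polyRes_surjective k _ v fun _ => exists_mem_star_of_mem_star_cons) (polyCoord k (star X u) v)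
    (polyCoord_mul_eq_zero _ v fun _ ha hv => mem_star_cons ha hv) q

variable (k) in
/-- Multiplication of forms on `St (v, u)` by `t_v²`, followed by extension by zero to `St u`. -/
def vertexExt (X : AbstractSimplicialComplex E) (q : ℕ) {n : ℕ} (v : E) (u : Fin n → E) :
    Forms k q (star X (Fin.cons v u : Fin (n + 1) → E)) →ₗ[k] Forms k q (star X u) :=
  (exists_vertexExt X q v u).choose

theorem vertexExt_formRes (X : AbstractSimplicialComplex E) (q : ℕ) {n : ℕ} (v : E)
    (u : Fin n → E) (ω : Forms k q (star X u)) :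
    vertexExt k X q v u (formRes k q (star_cons_le X v u) ω) =
      polyCoord k (star X u) v ^ 2 • ω :=
  (exists_vertexExt X q v u).choose_spec ω

/-- Every form on `St (v, u')` is restricted from `St u'`, so the claim reduces to the compatibility
of `t_v²` with restriction. -/
theorem formRes_vertexExt (X : AbstractSimplicialComplex E) (q : ℕ) {m n : ℕ} (v : E)
    {u : Fin n → E} {u' : Fin m → E} (h : star X u ≤ star X u')
    (h' : star X (Fin.cons v u : Fin (n + 1) → E) ≤ star X (Fin.cons v u' : Fin (m + 1) → E))
    (ω : Forms k q (star X (Fin.cons v u' : Fin (m + 1) → E))) :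
    formRes k q h (vertexExt k X q v u' ω) = vertexExt k X q v u (formRes k q h' ω) := by
  obtain ⟨ω, rfl⟩ := formRes_star_cons_surjective X q v u' ω
  rw [vertexExt_formRes, formRes_smul, formRes_formRes, map_pow, polyRes_polyCoord,
    ← vertexExt_formRes, formRes_formRes]

end FormExtension

/-! ## The contracting homotopy -/

section Homotopy

variable {k : Type*} [Field k] {E : Type*}

theorem deltaFun_deltaFun (X : AbstractSimplicialComplex E) (q n : ℕ)
    (ω : ∀ u : Fin n → E, Forms k q (star X u)) :
    deltaFun k X q (n + 1) (deltaFun k X q n ω) = 0 := by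
  funext s
  simp only [deltaFun_apply, map_sum, map_zsmul, formRes_formRes, Finset.smul_sum, smul_smul,
    ← pow_add, Pi.zero_apply]
  rw [← Finset.sum_product']
  have hcomp (i : Fin (n + 2)) (j : Fin (n + 1)) :
      (s ∘ (i.succAbove j).succAbove) ∘ (j.predAbove i).succAbove =
        (s ∘ i.succAbove) ∘ j.succAbove := by
    funext x
    simp only [Function.comp_apply, Fin.succAbove_succAbove_succAbove_predAbove]
  -- The involution exchanges the two orders of omitting the same two entries; the signs are
  -- opposite.
  refine Finset.sum_involution (fun x _ => (x.1.succAbove x.2, x.2.predAbove x.1)) ?_ ?_ ?_ ?_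
  · rintro ⟨i, j⟩ -
    dsimp only
    rw [Fin.neg_one_pow_succAbove_add_predAbove, neg_smul, ← sub_eq_add_neg, sub_eq_zero]
    exact congrArg _ (formRes_congr k (hcomp i j).symm _ _)
  · rintro ⟨i, j⟩ - - h
    exact Fin.succAbove_ne i j (congrArg Prod.fst h)
  · simp
  · rintro ⟨i, j⟩ -
    refine Prod.ext (Fin.succAbove_succAbove_predAbove i j) ?_
    exact Fin.predAbove_predAbove_succAbove i j

variable [Fintype E]

/-- The homotopy `(hω)_u = ∑ v, g_v t_v² ω_{(v, u)}`, for functions `g_v` on `X`. -/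
def homotopyFun (X : AbstractSimplicialComplex E) (q : ℕ)
    (g : E → PolyFun k X.toPreAbstractSimplicialComplex) {n : ℕ}
    (ω : ∀ u : Fin (n + 1) → E, Forms k q (star X u)) (u : Fin n → E) : Forms k q (star X u) :=
  ∑ v, polyRes k (star_le X u) (g v) • vertexExt k X q v u (ω (Fin.cons v u))

variable (X : AbstractSimplicialComplex E) (q : ℕ)
  (g : E → PolyFun k X.toPreAbstractSimplicialComplex)

/-- Serves both for permuting the entries of `u` and for omitting one. -/
theorem formRes_homotopyFun {m n : ℕ} (ω : ∀ u : Fin (n + 1) → E, Forms k q (star X u))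
    {u : Fin m → E} {u' : Fin n → E} (h : star X u ≤ star X u')
    (h' : ∀ v, star X (Fin.cons v u : Fin (m + 1) → E) ≤
      star X (Fin.cons v u' : Fin (n + 1) → E)) :
    formRes k q h (homotopyFun X q g ω u') =
      ∑ v, polyRes k (star_le X u) (g v) •
        vertexExt k X q v u (formRes k q (h' v) (ω (Fin.cons v u'))) := by
  rw [homotopyFun, map_sum]
  refine Finset.sum_congr rfl fun v _ => ?_
  rw [formRes_smul, formRes_vertexExt X q v h (h' v)]
  rfl

theorem homotopyFun_mem {n : ℕ} {ω : ∀ u : Fin (n + 1) → E, Forms k q (star X u)}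
    (hω : ω ∈ cochains k X q (n + 1)) : homotopyFun X q g ω ∈ cochains k X q n := by
  intro σ u
  rw [formRes_homotopyFun X q g ω _ fun v => star_cons_le_star_cons_comp X v u σ, homotopyFun,
    Finset.smul_sum]
  refine Finset.sum_congr rfl fun v _ => ?_
  -- `τ` fixes the leading entry `v` and permutes the rest by `σ`, so its sign is that of `σ`.
  let τ : Equiv.Perm (Fin (n + 1)) := Equiv.Perm.decomposeFin.symm (0, σ)
  have hτ : (Fin.cons v (u ∘ σ) : Fin (n + 1) → E) = (Fin.cons v u : Fin (n + 1) → E) ∘ τ := by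
    funext i
    refine Fin.cases ?_ (fun i => ?_) i <;> simp [τ]
  have hsign : Equiv.Perm.sign τ = Equiv.Perm.sign σ := by simp [τ]
  rw [smul_comm, ← map_zsmul, ← hsign, ← hω τ (Fin.cons v u)]
  exact congrArg _ (congrArg _ (formRes_congr k hτ _ _))

theorem homotopyFun_formRes_sum (hg : ∑ v, g v * polyCoord k _ v ^ 2 = 1) {n : ℕ}
    (u : Fin n → E) (ω : Forms k q (star X u)) :
    ∑ v, polyRes k (star_le X u) (g v) •
      vertexExt k X q v u (formRes k q (star_cons_le X v u) ω) = ω := by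
  have h := congrArg (polyRes k (star_le X u)) hg
  simp only [map_sum, map_mul, map_pow, polyRes_polyCoord, map_one] at h
  simp only [vertexExt_formRes, smul_smul]
  rw [← Finset.sum_smul, h, one_smul]

theorem homotopyFun_deltaFun_zero (hg : ∑ v, g v * polyCoord k _ v ^ 2 = 1)
    (ω : ∀ u : Fin 0 → E, Forms k q (star X u)) :
    homotopyFun X q g (deltaFun k X q 0 ω) = ω := by
  funext u
  refine Eq.trans ?_ (homotopyFun_formRes_sum X q g hg u (ω u))
  refine Finset.sum_congr rfl fun v _ => ?_
  rw [deltaFun_apply, Fin.sum_univ_succ]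
  simp only [Finset.univ_eq_empty, Finset.sum_empty, add_zero, Fin.val_zero, pow_zero, one_smul]
  exact congrArg _ (congrArg _ (formRes_congr k (Subsingleton.elim _ _) _ _))

theorem homotopyFun_deltaFun_succ (hg : ∑ v, g v * polyCoord k _ v ^ 2 = 1) {n : ℕ}
    (ω : ∀ u : Fin (n + 1) → E, Forms k q (star X u)) :
    homotopyFun X q g (deltaFun k X q (n + 1) ω) + deltaFun k X q n (homotopyFun X q g ω) = ω := by
  funext u
  rw [Pi.add_apply, deltaFun_apply]
  simp only [formRes_homotopyFun X q g ω _ fun v => star_cons_le_star_cons_comp X v u _,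
    Finset.smul_sum]
  rw [Finset.sum_comm, homotopyFun, ← Finset.sum_add_distrib]
  -- Writing `ω_u` as `∑ g_v t_v² ω_u` allows a comparison for each `v` separately: the term of `δω`
  -- omitting `v` from `(v, u)` gives `g_v t_v² ω_u`, and the others must cancel.
  refine Eq.trans ?_ (homotopyFun_formRes_sum X q g hg u (ω u))
  refine Finset.sum_congr rfl fun v _ => ?_
  rw [deltaFun_apply, Fin.sum_univ_succ]
  simp only [Fin.val_zero, pow_zero, one_smul, map_add, map_sum, smul_add, Finset.smul_sum,
    map_zsmul, Fin.val_succ, pow_succ, mul_neg, mul_one, neg_smul, map_neg, smul_neg]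
  rw [add_assoc, ← Finset.sum_add_distrib]
  convert add_zero _ using 2
  -- Omitting entry `i + 1` of `(v, u)` is omitting entry `i` of `u` and then prefixing `v`; the
  -- index shift makes the signs opposite.
  · refine Finset.sum_eq_zero fun i _ => ?_
    rw [smul_comm, neg_add_eq_zero]
    refine congrArg _ (congrArg _ (congrArg _ (formRes_congr k ?_ _ _)))
    exact Fin.cons_comp_succ_succAbove v u i
  · exact congrArg _ (formRes_congr k rfl _ _)

end Homotopy

/-! ### The augmentation and the exactness of the complex -/

theorem formsToCochains_bijective {k : Type*} [Field k] {E : Type*}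
    (X : AbstractSimplicialComplex E) (q : ℕ) : Function.Bijective (formsToCochains k X q) := by
  have h (u : Fin 0 → E) : X.toPreAbstractSimplicialComplex ≤ star X u := fun s hs =>
    ⟨(X.isRelLowerSet_faces hs).1, s, hs, subset_rfl, fun i => i.elim0⟩
  constructor
  · intro ω η hωη
    have h1 : formRes k q (star_le X Fin.elim0) ω = formRes k q (star_le X Fin.elim0) η :=
      congrFun (congrArg Subtype.val hωη) Fin.elim0
    simpa only [formRes_formRes, formRes_self] using congrArg (formRes k q (h Fin.elim0)) h1
  · intro ω
    refine ⟨formRes k q (h Fin.elim0) (ω.1 Fin.elim0), Subtype.ext (funext fun u => ?_)⟩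
    obtain rfl := Subsingleton.elim Fin.elim0 u
    change formRes k q _ (formRes k q _ _) = _
    rw [formRes_formRes, formRes_self]

end PolyForms

end

theorem mainTheorem2 {k : Type*} [Field k] [CharZero k] {E : Type*} [Finite E]
    (X : AbstractSimplicialComplex E) (q : ℕ) :
    -- `Ω^q(X) = C^{-1,q}`
    Function.Bijective (PolyForms.formsToCochains k X q) ∧
    -- exactness at `C^{-1,q}`
    Function.Injective (PolyForms.delta k X q 0) ∧
    -- exactness at `C^{p,q}` for all `p = n ≥ 0`
    ∀ n : ℕ, Function.Exact (PolyForms.delta k X q n) (PolyForms.delta k X q (n + 1)) := by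
  have := Fintype.ofFinite E
  obtain ⟨g, hg⟩ := PolyForms.exists_sum_mul_sq_polyCoord k
    (Y := X.toPreAbstractSimplicialComplex)
  refine ⟨PolyForms.formsToCochains_bijective X q, ?_, fun n ω => ⟨fun hω => ?_, ?_⟩⟩
  · intro ω η h
    have h1 : PolyForms.deltaFun k X q 0 ω.1 = PolyForms.deltaFun k X q 0 η.1 :=
      congrArg Subtype.val h
    have h2 := congrArg (PolyForms.homotopyFun X q g) h1
    rw [PolyForms.homotopyFun_deltaFun_zero X q g hg,
      PolyForms.homotopyFun_deltaFun_zero X q g hg] at h2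
    exact Subtype.ext h2
  -- For a cocycle `ω` the homotopy identity reads `δ(hω) = ω`, and `hω` is again alternating.
  · have h1 : PolyForms.deltaFun k X q (n + 1) ω.1 = 0 := congrArg Subtype.val hω
    have h2 := PolyForms.homotopyFun_deltaFun_succ X q g hg ω.1
    have h3 : PolyForms.homotopyFun X q g (n := n + 1) 0 = 0 := by
      funext u
      simp [PolyForms.homotopyFun]
    rw [h1, h3, zero_add] at h2
    exact ⟨⟨_, PolyForms.homotopyFun_mem X q g ω.2⟩, Subtype.ext h2⟩
  · rintro ⟨η, rfl⟩
    exact Subtype.ext (PolyForms.deltaFun_deltaFun X q n η.1)
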